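/- Let $G_0$ be a Lie group that is a covering of a closed subgroup $\underline{G}_0\subset GL(n,\mathbb R)$, let $\rho:G_0\to GL(n,\mathbb R)$ be the induced homomorphism and $K$ the kernel of the covering homomorphism $G_0\to\underline{G}_0$. Throughout, $M$ is a smooth manifold of dimension $n+k$ with an involutive smooth distribution $F\subset TM$ of rank $n$, $p:\mathcal G_0\to M$ is a smooth principal bundle with structure group $G_0$ and principal right action $r^g(u)=u\cdot g$, and $\mathcal PF\to M$ is the linear frame bundle of $F$, whose fiber over $x$ consists of the linear isomorphisms $\mathbb R^n\to F_x$. Put $\widetilde F_u:=(T_up)^{-1}(F_{p(u)})\subset T_u\mathcal G_0$. A partial $G_0$-structure of codimension $k$ is such a bundle together with a smooth fiber bundle morphism $\Phi:\mathcal G_0\to\mathcal PF$ over $\operatorname{id}_M$ with $\Phi(u\cdot g)=\Phi(u)\circ\rho(g)$. A smooth section $\theta\in\Gamma(L(\widetilde F,\mathbb R^n))$ is called strictly horizontal if $\ker\theta(u)=\ker T_up$ for all $u$, and $G_0$-equivariant if $\theta(u\cdot g)(T_ur^g\,\xi)=\rho(g)^{-1}\theta(u)(\xi)$ for all $g\in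 G_0$, $u\in\mathcal G_0$, $\xi\in\widetilde F_u$. (1) The assignment $\Phi\mapsto\theta$, $\theta(u)(\xi):=\Phi(u)^{-1}(T_up\,\xi)$, is a bijection from the set of morphisms $\Phi$ as above onto the set of strictly horizontal, $G_0$-equivariant smooth sections $\theta\in\Gamma(L(\widetilde F,\mathbb R^n))$. (2) Let $(\mathcal G_0^i\to M^i,F^i,\Phi^i)$, $i=1,2$, be partial $G_0$-structures of codimensions $k_1,k_2$ with corresponding forms $\theta^i$, and let $\Psi:\mathcal G_0^1\to\mathcal G_0^2$ be a homomorphism of principal bundles whose base map $\psi:M^1\to M^2$ has the property that every $T_x\psi$ restricts to a linear isomorphism $F^1_x\to F^2_{\psi(x)}$. Then $T_u\Psi(\widetilde F^1_u)\subset\widetilde F^2_{\Psi(u)}$ for all $u$, so that $(\Psi^*\theta^2)(u)(\xi):=\theta^2(\Psi(u))(T_u\Psi\,\xi)$ is well defined, and it is a smooth section of $L(\widetilde F^1,\mathbb R^n)$. Moreover $\Psi$ is a morphism of partial $G_0$-structures, i.e. $\Phi^2(\Psi(u))=T_{p^1(u)}\psi\circ\Phi^1(u)$ for all $u\in\mathcal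 G^1_0$, if and only if $\Psi^*\theta^2=\theta^1$. (3) If $\Psi,\widetilde\Psi:\mathcal G_0^1\to\mathcal G_0^2$ are two morphisms of partial $G_0$-structures (as in (2), including the condition on the base map) with the same base map, then there is a locally constant function $g:\mathcal G_0^1\to K$ such that $\widetilde\Psi(u)=\Psi(u)\cdot g(u)$ for all $u\in\mathcal G_0^1$. -/

import Mathlib

open Set Bundle
open scoped Manifold ContDiff RightActions

noncomputable section

namespace PartialGStr

/-- The model vector space `ℝⁿ`. -/
abbrev Rn (n : ℕ) : Type := EuclideanSpace ℝ (Fin n)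

/-- `GL(n, ℝ)`, with the Lie group structure Mathlib puts on the units of a Banach algebra. -/
abbrev GLn (n : ℕ) : Type := (Rn n →L[ℝ] Rn n)ˣ

/-- The linear automorphism of `ℝⁿ` given by an element of `GL(n, ℝ)`. -/
def GLn.toEquiv {n : ℕ} (A : GLn n) : Rn n ≃ₗ[ℝ] Rn n :=
  (ContinuousLinearEquiv.unitsEquiv ℝ (Rn n) A).toLinearEquiv

/-! ### Coverings of closed subgroups of `GL(n, ℝ)` -/

section Group

variable (n : ℕ) {𝔤 : Type*} [NormedAddCommGroup 𝔤] [NormedSpace ℝ 𝔤]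
  (G : Type*) [TopologicalSpace G] [ChartedSpace 𝔤 G] [Group G]

/-- A presentation of the Lie group `G` as a covering of a closed subgroup of `GL(n, ℝ)`: a
closed subgroup and a surjective smooth homomorphism onto it that is a covering map. -/
structure Covering where
  /-- the closed subgroup of `GL(n, ℝ)` that is covered -/
  sub : Subgroup (GLn n)
  isClosed_sub : IsClosed (sub : Set (GLn n))
  /-- the covering homomorphism -/
  cov : G →* sub
  surjective_cov : Function.Surjective cov
  isCoveringMap_cov : IsCoveringMap cov
  smooth_cov : ContMDiff 𝓘(ℝ, 𝔤) 𝓘(ℝ, Rn n →L[ℝ] Rn n) ∞ (fun g : G => (cov g : GLn n))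

variable {n G}

/-- The induced homomorphism `G → GL(n, ℝ)`. -/
def Covering.rep (c : Covering (𝔤 := 𝔤) n G) : G →* GLn n := c.sub.subtype.comp c.cov

/-- The kernel of the covering homomorphism. -/
def Covering.kernel (c : Covering (𝔤 := 𝔤) n G) : Subgroup G := c.cov.ker

end Group

/-! ### Distributions and their frame bundles -/

section Distribution

variable (n : ℕ) (E : Type*) [NormedAddCommGroup E] [NormedSpace ℝ E]
  (M : Type*) [TopologicalSpace M] [ChartedSpace E M] [IsManifold 𝓘(ℝ, E) ∞ M]

variable {M} in
/-- `X` is smooth on the set `U`, as a section of the tangent bundle. -/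
def SmoothFieldOn (X : ∀ x : M, TangentSpace 𝓘(ℝ, E) x) (U : Set M) : Prop :=
  ContMDiffOn 𝓘(ℝ, E) 𝓘(ℝ, E).tangent ∞
    (fun x => (⟨x, X x⟩ : TangentBundle 𝓘(ℝ, E) M)) U

/-- An involutive smooth distribution of rank `n` on `M`. -/
structure InvolutiveDistribution where
  /-- the subspace at each point -/
  space : ∀ x : M, Submodule ℝ (TangentSpace 𝓘(ℝ, E) x)
  rank_eq : ∀ x, Module.finrank ℝ (space x) = n
  /-- local smooth frames exist -/
  smooth : ∀ x₀ : M, ∃ U : Set M, IsOpen U ∧ x₀ ∈ U ∧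
    ∃ X : Fin n → ∀ x : M, TangentSpace 𝓘(ℝ, E) x,
      (∀ i, SmoothFieldOn E (X i) U) ∧
      ∀ x ∈ U, space x = Submodule.span ℝ (range fun i => X i x)
  involutive : ∀ (U : Set M) (X Y : ∀ x : M, TangentSpace 𝓘(ℝ, E) x), IsOpen U →
    SmoothFieldOn E X U → SmoothFieldOn E Y U →
    (∀ x ∈ U, X x ∈ space x) → (∀ x ∈ U, Y x ∈ space x) →
    ∀ x ∈ U, VectorField.mlieBracket 𝓘(ℝ, E) X Y x ∈ space x

variable {n E M}

/-- The linear frame bundle of the distribution `F`: pairs of a point `x` and a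
linear isomorphism `ℝⁿ → F x`. -/
structure FrameBundle (F : InvolutiveDistribution n E M) where
  /-- the base point -/
  base : M
  /-- the frame -/
  frame : Rn n ≃ₗ[ℝ] F.space base

namespace FrameBundle

variable {F : InvolutiveDistribution n E M}

/-- The principal right action of `GL(n, ℝ)` on the frame bundle. -/
def act (w : FrameBundle F) (A : GLn n) : FrameBundle F :=
  ⟨w.base, A.toEquiv.trans w.frame⟩

/-- The inclusion of the frame bundle into the vector bundle `Hom(ℝⁿ, TM)`. -/
def toHom (w : FrameBundle F) :
    TotalSpace (Rn n →L[ℝ] E)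
      (fun x : M => Bundle.Trivial M (Rn n) x →L[ℝ] TangentSpace 𝓘(ℝ, E) x) :=
  ⟨w.base, LinearMap.toContinuousLinearMap (E := Rn n) (F' := TangentSpace 𝓘(ℝ, E) w.base)
    ((F.space w.base).subtype ∘ₗ w.frame.toLinearMap)⟩

end FrameBundle

/-- Smoothness of a map from a manifold `N` to the frame bundle of `F`. The frame bundle is an
open subset of the subbundle `Hom(ℝⁿ, F)` of `Hom(ℝⁿ, TM)`, hence an embedded submanifold of
`Hom(ℝⁿ, TM)`: a map into it is smooth iff it is smooth as a map to `Hom(ℝⁿ, TM)`. -/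
def SmoothToFrameBundle {EN : Type*} [NormedAddCommGroup EN] [NormedSpace ℝ EN]
    {N : Type*} [TopologicalSpace N] [ChartedSpace EN N]
    {F : InvolutiveDistribution n E M} (f : N → FrameBundle F) : Prop :=
  ContMDiff 𝓘(ℝ, EN) (𝓘(ℝ, E).prod 𝓘(ℝ, Rn n →L[ℝ] E)) ∞ (fun u => (f u).toHom)

end Distribution

/-! ### Principal bundles -/

section Principal

variable (𝔤 : Type*) [NormedAddCommGroup 𝔤] [NormedSpace ℝ 𝔤]
  (G : Type*) [TopologicalSpace G] [ChartedSpace 𝔤 G] [Group G]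
  (E : Type*) [NormedAddCommGroup E] [NormedSpace ℝ E]
  (M : Type*) [TopologicalSpace M] [ChartedSpace E M]
  (EP : Type*) [NormedAddCommGroup EP] [NormedSpace ℝ EP]
  (P : Type*) [TopologicalSpace P] [ChartedSpace EP P] [MulAction Gᵐᵒᵖ P]

/-- A smooth principal bundle `p : P → M` with structure group `G`; the principal right action is
`u <• g`. Locally in `M` there are smooth equivariant trivializations. -/
structure PrincipalBundle where
  /-- the bundle projection -/
  proj : P → M
  smooth_proj : ContMDiff 𝓘(ℝ, EP) 𝓘(ℝ, E) ∞ proj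
  smooth_act : ContMDiff (𝓘(ℝ, EP).prod 𝓘(ℝ, 𝔤)) 𝓘(ℝ, EP) ∞ (fun q : P × G => q.1 <• q.2)
  proj_act : ∀ (u : P) (g : G), proj (u <• g) = proj u
  locally_trivial : ∀ x : M, ∃ e : Trivialization G proj, x ∈ e.baseSet ∧
    ContMDiffOn 𝓘(ℝ, EP) (𝓘(ℝ, E).prod 𝓘(ℝ, 𝔤)) ∞ e e.source ∧
    ContMDiffOn (𝓘(ℝ, E).prod 𝓘(ℝ, 𝔤)) 𝓘(ℝ, EP) ∞ e.toOpenPartialHomeomorph.symm e.target ∧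
    ∀ u ∈ e.source, ∀ g : G, (e (u <• g)).2 = (e u).2 * g

end Principal

section Hom

variable {𝔤 : Type*} [NormedAddCommGroup 𝔤] [NormedSpace ℝ 𝔤]
  {G : Type*} [TopologicalSpace G] [ChartedSpace 𝔤 G] [Group G]
  {E₁ : Type*} [NormedAddCommGroup E₁] [NormedSpace ℝ E₁]
  {M₁ : Type*} [TopologicalSpace M₁] [ChartedSpace E₁ M₁]
  {EP₁ : Type*} [NormedAddCommGroup EP₁] [NormedSpace ℝ EP₁]
  {P₁ : Type*} [TopologicalSpace P₁] [ChartedSpace EP₁ P₁] [MulAction Gᵐᵒᵖ P₁]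
  {E₂ : Type*} [NormedAddCommGroup E₂] [NormedSpace ℝ E₂]
  {M₂ : Type*} [TopologicalSpace M₂] [ChartedSpace E₂ M₂]
  {EP₂ : Type*} [NormedAddCommGroup EP₂] [NormedSpace ℝ EP₂]
  {P₂ : Type*} [TopologicalSpace P₂] [ChartedSpace EP₂ P₂] [MulAction Gᵐᵒᵖ P₂]

/-- A homomorphism of principal `G`-bundles, together with its base map. -/
structure PrincipalBundleHom (B₁ : PrincipalBundle 𝔤 G E₁ M₁ EP₁ P₁)
    (B₂ : PrincipalBundle 𝔤 G E₂ M₂ EP₂ P₂) where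
  /-- the map of total spaces -/
  toFun : P₁ → P₂
  /-- the base map -/
  base : M₁ → M₂
  smooth_toFun : ContMDiff 𝓘(ℝ, EP₁) 𝓘(ℝ, EP₂) ∞ toFun
  smooth_base : ContMDiff 𝓘(ℝ, E₁) 𝓘(ℝ, E₂) ∞ base
  proj_toFun : ∀ u, B₂.proj (toFun u) = base (B₁.proj u)
  equivariant : ∀ (u : P₁) (g : G), toFun (u <• g) = toFun u <• g

end Hom

/-! ### Partial forms on the total space of a principal bundle -/

section Forms

variable {n : ℕ} {𝔤 : Type*} [NormedAddCommGroup 𝔤] [NormedSpace ℝ 𝔤]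
  {G : Type*} [TopologicalSpace G] [ChartedSpace 𝔤 G] [Group G]
  {E : Type*} [NormedAddCommGroup E] [NormedSpace ℝ E]
  {M : Type*} [TopologicalSpace M] [ChartedSpace E M] [IsManifold 𝓘(ℝ, E) ∞ M]
  {EP : Type*} [NormedAddCommGroup EP] [NormedSpace ℝ EP]
  {P : Type*} [TopologicalSpace P] [ChartedSpace EP P] [IsManifold 𝓘(ℝ, EP) ∞ P]
  [MulAction Gᵐᵒᵖ P]

/-- The tangent map `T_u p` of the bundle projection. -/
def PrincipalBundle.tproj (B : PrincipalBundle 𝔤 G E M EP P) (u : P) :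
    TangentSpace 𝓘(ℝ, EP) u →ₗ[ℝ] TangentSpace 𝓘(ℝ, E) (B.proj u) :=
  (mfderiv 𝓘(ℝ, EP) 𝓘(ℝ, E) B.proj u).toLinearMap

/-- The preimage distribution `F̃_u = (T_u p)⁻¹(F_{p(u)})` on the total space. -/
def lift (F : InvolutiveDistribution n E M) (B : PrincipalBundle 𝔤 G E M EP P) (u : P) :
    Submodule ℝ (TangentSpace 𝓘(ℝ, EP) u) :=
  (F.space (B.proj u)).comap (B.tproj u)

/-- A not necessarily smooth section of `L(F̃, ℝⁿ)`. -/
abbrev RoughForm (F : InvolutiveDistribution n E M) (B : PrincipalBundle 𝔤 G E M EP P) :=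
  ∀ u : P, lift F B u →ₗ[ℝ] Rn n

/-- Smoothness of a section of `L(F̃, ℝⁿ)`: inserting a local smooth section of `F̃` gives a smooth
function. (A section of `F̃` over an open set is written as the restriction of a rough section of
`F̃` over all of `P`.) -/
def RoughForm.IsSmooth {F : InvolutiveDistribution n E M} {B : PrincipalBundle 𝔤 G E M EP P}
    (θ : RoughForm F B) : Prop :=
  ∀ (W : Set P) (ξ : ∀ u : P, lift F B u), IsOpen W →
    SmoothFieldOn EP (fun u => (ξ u : TangentSpace 𝓘(ℝ, EP) u)) W →
    ContMDiffOn 𝓘(ℝ, EP) 𝓘(ℝ, Rn n) ∞ (fun u => θ u (ξ u)) W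

/-- `θ` is strictly horizontal: the kernel of `θ(u)` is the vertical subspace `ker T_u p`. -/
def RoughForm.IsStrictlyHorizontal {F : InvolutiveDistribution n E M}
    {B : PrincipalBundle 𝔤 G E M EP P} (θ : RoughForm F B) : Prop :=
  ∀ u : P, (LinearMap.ker (θ u)).map (lift F B u).subtype = LinearMap.ker (B.tproj u)

/-- The tangent maps of `f` map the preimage distribution to the preimage distribution. -/
def MapsLift {E₂ : Type*} [NormedAddCommGroup E₂] [NormedSpace ℝ E₂]
    {M₂ : Type*} [TopologicalSpace M₂] [ChartedSpace E₂ M₂] [IsManifold 𝓘(ℝ, E₂) ∞ M₂]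
    {EP₂ : Type*} [NormedAddCommGroup EP₂] [NormedSpace ℝ EP₂]
    {P₂ : Type*} [TopologicalSpace P₂] [ChartedSpace EP₂ P₂] [MulAction Gᵐᵒᵖ P₂]
    (F : InvolutiveDistribution n E M) (B : PrincipalBundle 𝔤 G E M EP P)
    (F₂ : InvolutiveDistribution n E₂ M₂) (B₂ : PrincipalBundle 𝔤 G E₂ M₂ EP₂ P₂)
    (f : P → P₂) : Prop :=
  ∀ u : P, ∀ ξ ∈ lift F B u, mfderiv 𝓘(ℝ, EP) 𝓘(ℝ, EP₂) f u ξ ∈ lift F₂ B₂ (f u)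

/-- The pullback `(f^*θ)(u)(ξ) = θ(f(u))(T_u f ξ)`. -/
def RoughForm.pullback {E₂ : Type*} [NormedAddCommGroup E₂] [NormedSpace ℝ E₂]
    {M₂ : Type*} [TopologicalSpace M₂] [ChartedSpace E₂ M₂] [IsManifold 𝓘(ℝ, E₂) ∞ M₂]
    {EP₂ : Type*} [NormedAddCommGroup EP₂] [NormedSpace ℝ EP₂]
    {P₂ : Type*} [TopologicalSpace P₂] [ChartedSpace EP₂ P₂] [MulAction Gᵐᵒᵖ P₂]
    {F : InvolutiveDistribution n E M} {B : PrincipalBundle 𝔤 G E M EP P}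
    {F₂ : InvolutiveDistribution n E₂ M₂} {B₂ : PrincipalBundle 𝔤 G E₂ M₂ EP₂ P₂}
    (θ : RoughForm F₂ B₂) (f : P → P₂) (hf : MapsLift F B F₂ B₂ f) : RoughForm F B :=
  fun u => θ (f u) ∘ₗ
    (mfderiv 𝓘(ℝ, EP) 𝓘(ℝ, EP₂) f u).toLinearMap.restrict (hf u)

/-- The preimage distribution is invariant under the principal right action. -/
theorem mapsLift_act (F : InvolutiveDistribution n E M) (B : PrincipalBundle 𝔤 G E M EP P) (g : G) :
    MapsLift F B F B (fun u : P => u <• g) := by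
  intro u ξ hξ
  have hact : ContMDiff 𝓘(ℝ, EP) 𝓘(ℝ, EP) ∞ (fun u : P => u <• g) :=
    B.smooth_act.comp (contMDiff_id.prodMk contMDiff_const)
  have hcomp : B.proj ∘ (fun u : P => u <• g) = B.proj := funext fun u => B.proj_act u g
  have hd := mfderiv_comp (I := 𝓘(ℝ, EP)) (I' := 𝓘(ℝ, EP)) (I'' := 𝓘(ℝ, E)) u
    ((B.smooth_proj (u <• g)).mdifferentiableAt (by simp))
    ((hact u).mdifferentiableAt (by simp))
  rw [hcomp] at hd
  have key : ∀ (x y : M), x = y → ∀ v : E,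
      (show TangentSpace 𝓘(ℝ, E) x from v) ∈ F.space x →
      (show TangentSpace 𝓘(ℝ, E) y from v) ∈ F.space y := by
    rintro x _ rfl v hv; exact hv
  refine key _ _ (B.proj_act u g).symm _ ?_
  have h2 : mfderiv 𝓘(ℝ, EP) 𝓘(ℝ, E) B.proj u ξ ∈ F.space (B.proj u) := hξ
  rw [hd] at h2
  exact h2

/-- `θ` is `G`-equivariant: `(r^g)^*θ = g⁻¹ ∘ θ` for all `g`, where `G` acts on `ℝⁿ` through the
homomorphism `G → GL(n, ℝ)`. -/
def RoughForm.IsEquivariant {F : InvolutiveDistribution n E M} {B : PrincipalBundle 𝔤 G E M EP P}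
    (c : Covering (𝔤 := 𝔤) n G) (θ : RoughForm F B) : Prop :=
  ∀ g : G, θ.pullback (fun u : P => u <• g) (mapsLift_act F B g) =
    fun u => (c.rep g⁻¹).toEquiv.toLinearMap ∘ₗ θ u

/-- A smooth fiber bundle morphism `Φ` from `P` to the frame bundle of `F` with base map the
identity, equivariant over `G → GL(n, ℝ)`: the datum that makes `P → M`, with the involutive
distribution `F`, a partial `G`-structure. -/
structure PartialStructure (c : Covering (𝔤 := 𝔤) n G) (F : InvolutiveDistribution n E M)
    (B : PrincipalBundle 𝔤 G E M EP P) where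
  /-- the map to the frame bundle -/
  toFun : P → FrameBundle F
  base_toFun : ∀ u, (toFun u).base = B.proj u
  smooth : SmoothToFrameBundle (EN := EP) toFun
  equivariant : ∀ (u : P) (g : G), toFun (u <• g) = (toFun u).act (c.rep g)

/-- `Φ(u)` as a linear isomorphism `ℝⁿ → F_{p(u)}`. -/
def PartialStructure.frameAt {c : Covering (𝔤 := 𝔤) n G} {F : InvolutiveDistribution n E M}
    {B : PrincipalBundle 𝔤 G E M EP P} (Φ : PartialStructure c F B) (u : P) :
    Rn n ≃ₗ[ℝ] F.space (B.proj u) :=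
  Eq.rec (motive := fun x _ => Rn n ≃ₗ[ℝ] F.space x) (Φ.toFun u).frame (Φ.base_toFun u)

/-- The partial form `θ(u)(ξ) = Φ(u)⁻¹(T_u p ξ)` defined by `Φ`. -/
def PartialStructure.form {c : Covering (𝔤 := 𝔤) n G} {F : InvolutiveDistribution n E M}
    {B : PrincipalBundle 𝔤 G E M EP P} (Φ : PartialStructure c F B) : RoughForm F B :=
  fun u => (Φ.frameAt u).symm.toLinearMap ∘ₗ (B.tproj u).restrict (fun _ hξ => hξ)

end Forms

/-! ### Morphisms of partial structures -/

section Morphisms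

variable {n : ℕ}
  {E₁ : Type*} [NormedAddCommGroup E₁] [NormedSpace ℝ E₁]
  {M₁ : Type*} [TopologicalSpace M₁] [ChartedSpace E₁ M₁] [IsManifold 𝓘(ℝ, E₁) ∞ M₁]
  {E₂ : Type*} [NormedAddCommGroup E₂] [NormedSpace ℝ E₂]
  {M₂ : Type*} [TopologicalSpace M₂] [ChartedSpace E₂ M₂] [IsManifold 𝓘(ℝ, E₂) ∞ M₂]

/-- Each tangent map `T_x f` restricts to a linear isomorphism from `F₁` at `x` to `F₂` at
`f x`. -/
def RestrictsToIso (F₁ : InvolutiveDistribution n E₁ M₁) (F₂ : InvolutiveDistribution n E₂ M₂)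
    (f : M₁ → M₂) : Prop :=
  ∀ x : M₁, BijOn (mfderiv 𝓘(ℝ, E₁) 𝓘(ℝ, E₂) f x) (F₁.space x) (F₂.space (f x))

variable {F₁ : InvolutiveDistribution n E₁ M₁} {F₂ : InvolutiveDistribution n E₂ M₂}
  {f : M₁ → M₂}

/-- The restriction of `T_x f` as a linear isomorphism `F₁ x → F₂ (f x)`. -/
def RestrictsToIso.equiv (h : RestrictsToIso F₁ F₂ f) (x : M₁) :
    F₁.space x ≃ₗ[ℝ] F₂.space (f x) :=
  LinearEquiv.ofBijective
    ((mfderiv 𝓘(ℝ, E₁) 𝓘(ℝ, E₂) f x).toLinearMap.restrict (h x).mapsTo) (h x).bijective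

/-- The map of frame bundles induced by `f`. -/
def RestrictsToIso.frameMap (h : RestrictsToIso F₁ F₂ f) (w : FrameBundle F₁) : FrameBundle F₂ :=
  ⟨f w.base, w.frame.trans (h.equiv w.base)⟩

variable {𝔤 : Type*} [NormedAddCommGroup 𝔤] [NormedSpace ℝ 𝔤]
  {G : Type*} [TopologicalSpace G] [ChartedSpace 𝔤 G] [Group G]
  {EP₁ : Type*} [NormedAddCommGroup EP₁] [NormedSpace ℝ EP₁]
  {P₁ : Type*} [TopologicalSpace P₁] [ChartedSpace EP₁ P₁] [MulAction Gᵐᵒᵖ P₁]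
  {EP₂ : Type*} [NormedAddCommGroup EP₂] [NormedSpace ℝ EP₂]
  {P₂ : Type*} [TopologicalSpace P₂] [ChartedSpace EP₂ P₂] [MulAction Gᵐᵒᵖ P₂]
  {c : Covering (𝔤 := 𝔤) n G}
  {B₁ : PrincipalBundle 𝔤 G E₁ M₁ EP₁ P₁} {B₂ : PrincipalBundle 𝔤 G E₂ M₂ EP₂ P₂}

/-- A principal bundle homomorphism `Ψ` with base map `ψ` is a morphism of partial structures if
the tangent maps of `ψ` restrict to isomorphisms on the distributions and the maps to the frame
bundles are intertwined by `Ψ` and the map of frame bundles induced by `ψ`. -/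
def IsMorphism (Φ₁ : PartialStructure c F₁ B₁) (Φ₂ : PartialStructure c F₂ B₂)
    (Ψ : PrincipalBundleHom B₁ B₂) : Prop :=
  ∃ h : RestrictsToIso F₁ F₂ Ψ.base,
    ∀ u : P₁, Φ₂.toFun (Ψ.toFun u) = h.frameMap (Φ₁.toFun u)

end Morphisms

end PartialGStr

end

/-!
The tangent map `T_u p` of a principal bundle maps `F̃_u` onto `F_{p(u)}` with kernel the vertical
space, so giving an isomorphism `Φ(u) : ℝⁿ ≃ F_{p(u)}` is the same as giving a linear map
`θ(u) : F̃_u → ℝⁿ` with kernel `ker T_u p`; the two are tied by the equation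
`Φ(u) (θ(u) ξ) = T_u p ξ` (`PartialStructure.form_eq_iff`), from which the algebraic assertions
follow. The matching dimension count is in `RoughForm.IsStrictlyHorizontal.exists_frame`.

Smoothness passes both ways by inverting matrices. If `Φ` is smooth, then `θ(ξ)` is the solution of
a linear system whose injective coefficient map and right-hand side are smooth in a trivialization
of `TM` (`contMDiffAt_of_injective_apply_eq`, `contMDiffAt_of_vec_eq`). Conversely, a local smooth
frame of `F` lifts to smooth sections of `F̃` by means of the local sections of the bundle
(`PrincipalBundle.exists_local_lift`); the values of a smooth `θ` on these sections form an
invertible smooth matrix, and `Φ` is the frame times its inverse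
(`RoughForm.IsSmooth.smoothToFrameBundle`).

For a bundle homomorphism `Ψ` over `ψ`, the chain rule `Tp² ∘ TΨ = Tψ ∘ Tp¹` turns `Ψ^*θ² = θ¹` into
`Φ²(Ψ(u)) = Tψ ∘ Φ¹(u)`. Two morphisms over the same base map differ by a continuous
function `g` into the group (`PrincipalBundle.exists_continuous_act_eq`). They induce the same
frames, and `GL(n, ℝ)` acts freely on frames, so `g` takes values in the kernel of the covering,
which is a fiber of a covering map and hence discrete.
-/

noncomputable section

namespace PartialGStr

open Filter Topology

/-! ### The tangent bundle in coordinates -/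

section Coordinates

variable {E : Type*} [NormedAddCommGroup E] [NormedSpace ℝ E]
  {M : Type*} [TopologicalSpace M] [ChartedSpace E M] [IsManifold 𝓘(ℝ, E) ∞ M]
  {EN : Type*} [NormedAddCommGroup EN] [NormedSpace ℝ EN]
  {N : Type*} [TopologicalSpace N] [ChartedSpace EN N]

/-- The coordinate expression `T_x M → E` in the preferred trivialization at `x₀`; it is the zero
map where this trivialization is not defined. -/
def tangentCoord (x₀ x : M) : TangentSpace 𝓘(ℝ, E) x →L[ℝ] E :=
  (trivializationAt E (TangentSpace 𝓘(ℝ, E)) x₀).continuousLinearMapAt ℝ x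

theorem eventually_mem_trivializationAt_baseSet {f : N → M} {u₀ : N} (hf : ContinuousAt f u₀) :
    ∀ᶠ u in 𝓝 u₀, f u ∈ (trivializationAt E (TangentSpace 𝓘(ℝ, E)) (f u₀)).baseSet :=
  hf.eventually ((trivializationAt E (TangentSpace 𝓘(ℝ, E)) (f u₀)).open_baseSet.mem_nhds
    (FiberBundle.mem_baseSet_trivializationAt' (f u₀)))

theorem tangentCoord_injective {x₀ x : M}
    (hx : x ∈ (trivializationAt E (TangentSpace 𝓘(ℝ, E)) x₀).baseSet) :
    Function.Injective (tangentCoord (E := E) x₀ x) :=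
  Function.LeftInverse.injective (g := (trivializationAt E (TangentSpace 𝓘(ℝ, E)) x₀).symmL ℝ x)
    fun y => Trivialization.symmL_continuousLinearMapAt (R := ℝ) _ hx y

theorem contMDiffAt_tangentBundle_iff {v : N → TangentBundle 𝓘(ℝ, E) M} {u₀ : N} :
    ContMDiffAt 𝓘(ℝ, EN) 𝓘(ℝ, E).tangent ∞ v u₀ ↔
      ContMDiffAt 𝓘(ℝ, EN) 𝓘(ℝ, E) ∞ (fun u => (v u).1) u₀ ∧
      ContMDiffAt 𝓘(ℝ, EN) 𝓘(ℝ, E) ∞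
        (fun u => tangentCoord (E := E) (v u₀).1 (v u).1 (v u).2) u₀ := by
  refine (contMDiffAt_totalSpace (f := v) (F := E) (E := TangentSpace 𝓘(ℝ, E))
    (IB := 𝓘(ℝ, E))).trans
    (and_congr_right fun hb => Filter.EventuallyEq.contMDiffAt_iff ?_)
  filter_upwards [eventually_mem_trivializationAt_baseSet (E := E) hb.continuousAt] with u hu
  exact (Trivialization.continuousLinearMapAt_apply_of_mem (R := ℝ) _ hu _).symm

theorem contMDiffAt_homBundle_iff {V : Type*} [NormedAddCommGroup V] [NormedSpace ℝ V]
    {φ : N → TotalSpace (V →L[ℝ] E)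
      (fun x : M => Bundle.Trivial M V x →L[ℝ] TangentSpace 𝓘(ℝ, E) x)} {u₀ : N} :
    ContMDiffAt 𝓘(ℝ, EN) (𝓘(ℝ, E).prod 𝓘(ℝ, V →L[ℝ] E)) ∞ φ u₀ ↔
      ContMDiffAt 𝓘(ℝ, EN) 𝓘(ℝ, E) ∞ (fun u => (φ u).1) u₀ ∧
      ContMDiffAt 𝓘(ℝ, EN) 𝓘(ℝ, V →L[ℝ] E) ∞
        (fun u => (tangentCoord (E := E) (φ u₀).1 (φ u).1 ∘L (φ u).2 : V →L[ℝ] E)) u₀ := by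
  refine (contMDiffAt_hom_bundle (F₁ := V) (F₂ := E) (E₁ := Bundle.Trivial M V)
    (E₂ := fun x : M => TangentSpace 𝓘(ℝ, E) x) (IB := 𝓘(ℝ, E)) φ).trans
    (and_congr_right fun hb => ?_)
  refine iff_of_eq (congrArg (fun F => ContMDiffAt _ _ _ F u₀) (funext fun u => ?_))
  ext v
  have := ContinuousLinearMap.ext_iff.1
    (Bundle.Trivial.symmL_trivialization (𝕜 := ℝ) (B := M) (F := V) (φ u).1) v
  exact congrArg (fun w => tangentCoord (E := E) (φ u₀).1 (φ u).1 ((φ u).2 w)) this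

end Coordinates

/-! ### Smooth families of linear equations -/

section LinearAlgebra

variable {EN : Type*} [NormedAddCommGroup EN] [NormedSpace ℝ EN]
  {N : Type*} [TopologicalSpace N] [ChartedSpace EN N]
  {V : Type*} [NormedAddCommGroup V] [NormedSpace ℝ V]
  {W : Type*} [NormedAddCommGroup W] [NormedSpace ℝ W]

theorem contMDiffAt_ringInverse [CompleteSpace V] {A : N → V →L[ℝ] V} {u₀ : N}
    (hA : ContMDiffAt 𝓘(ℝ, EN) 𝓘(ℝ, V →L[ℝ] V) ∞ A u₀) (h₀ : IsUnit (A u₀)) :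
    ContMDiffAt 𝓘(ℝ, EN) 𝓘(ℝ, V →L[ℝ] V) ∞ (fun u => Ring.inverse (A u)) u₀ := by
  obtain ⟨a, ha⟩ := h₀
  have h := contDiffAt_ringInverse ℝ (n := ∞) a
  rw [ha] at h
  exact h.contMDiffAt.comp u₀ hA

theorem eventually_isUnit [CompleteSpace V] {A : N → V →L[ℝ] V} {u₀ : N}
    (hA : ContinuousAt A u₀) (h₀ : IsUnit (A u₀)) : ∀ᶠ u in 𝓝 u₀, IsUnit (A u) :=
  hA.eventually (Units.isOpen.mem_nhds h₀)

theorem ringInverse_apply_apply {A : V →L[ℝ] V} (hA : IsUnit A) (z : V) :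
    Ring.inverse A (A z) = z :=
  ContinuousLinearMap.ext_iff.1 (Ring.inverse_mul_cancel A hA) z

theorem apply_ringInverse_apply {A : V →L[ℝ] V} (hA : IsUnit A) (z : V) :
    A (Ring.inverse A z) = z :=
  ContinuousLinearMap.ext_iff.1 (Ring.mul_inverse_cancel A hA) z

/-- The solution `z` of `A z = w`, for `A` injective, depends smoothly on `A` and `w`: a left
inverse `L` of `A u₀` turns the equation into `(L A) z = L w` with `L A` invertible near `u₀`. -/
theorem contMDiffAt_of_injective_apply_eq [FiniteDimensional ℝ V] [FiniteDimensional ℝ W]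
    {A : N → V →L[ℝ] W} {w : N → W} {z : N → V} {u₀ : N}
    (hA : ContMDiffAt 𝓘(ℝ, EN) 𝓘(ℝ, V →L[ℝ] W) ∞ A u₀)
    (hw : ContMDiffAt 𝓘(ℝ, EN) 𝓘(ℝ, W) ∞ w u₀) (h₀ : Function.Injective (A u₀))
    (hz : ∀ᶠ u in 𝓝 u₀, A u (z u) = w u) :
    ContMDiffAt 𝓘(ℝ, EN) 𝓘(ℝ, V) ∞ z u₀ := by
  have := FiniteDimensional.complete ℝ V
  obtain ⟨L, hL⟩ : ∃ L : W →L[ℝ] V, L ∘L A u₀ = ContinuousLinearMap.id ℝ V := by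
    obtain ⟨L, hL⟩ := ContinuousLinearMap.HasLeftInverse.of_injective_of_finiteDimensional h₀
    exact ⟨L, ContinuousLinearMap.ext hL⟩
  have hLA : ContMDiffAt 𝓘(ℝ, EN) 𝓘(ℝ, V →L[ℝ] V) ∞ (fun u => L ∘L A u) u₀ :=
    contMDiffAt_const.clm_comp hA
  have hU : IsUnit (L ∘L A u₀) := by rw [hL]; exact isUnit_one
  have hLw : ContMDiffAt 𝓘(ℝ, EN) 𝓘(ℝ, V) ∞ (fun u => L (w u)) u₀ :=
    contMDiffAt_const.clm_apply hw
  refine ((contMDiffAt_ringInverse hLA hU).clm_apply hLw).congr_of_eventuallyEq ?_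
  filter_upwards [hz, eventually_isUnit hLA.continuousAt hU] with u hu hu'
  rw [← hu]
  exact (ringInverse_apply_apply hu' (z u)).symm

end LinearAlgebra

/-! ### Frames of a distribution -/

section Frames

variable {n : ℕ} {E : Type*} [NormedAddCommGroup E] [NormedSpace ℝ E]
  {M : Type*} [TopologicalSpace M] [ChartedSpace E M] [IsManifold 𝓘(ℝ, E) ∞ M]
  {F : InvolutiveDistribution n E M}

/-- The vector `w z`, for a frame `w : ℝⁿ ≃ F_x`, read in the model space `E`, to which every
tangent space of `M` is definitionally equal. Frames at propositionally equal points can thus be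
compared without transport. -/
def FrameBundle.vec (w : FrameBundle F) (z : Rn n) : E := (w.frame z).1

theorem FrameBundle.vec_injective (w : FrameBundle F) : Function.Injective w.vec :=
  fun _ _ h => w.frame.injective (Subtype.ext h)

theorem FrameBundle.ext_vec {w w' : FrameBundle F} (hb : w.base = w'.base)
    (h : ∀ z, w.vec z = w'.vec z) : w = w' := by
  obtain ⟨x, f⟩ := w
  obtain ⟨x', f'⟩ := w'
  obtain rfl : x = x' := hb
  congr 1
  exact LinearEquiv.ext fun z => Subtype.ext (h z)

theorem FrameBundle.vec_act (w : FrameBundle F) (A : GLn n) (z : Rn n) :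
    (w.act A).vec z = w.vec (A.toEquiv z) := rfl

/-- The general linear group acts freely on frames. -/
theorem FrameBundle.eq_one_of_act_eq {w : FrameBundle F} {A : GLn n} (h : w.act A = w) : A = 1 := by
  refine Units.ext (ContinuousLinearMap.ext fun z => w.vec_injective ?_)
  exact congrArg (fun w' : FrameBundle F => w'.vec z) h

omit [IsManifold 𝓘(ℝ, E) ∞ M] in
/-- Equality of tangent vectors whose base points are only propositionally equal is checked in the
model space. -/
theorem totalSpace_mk_congr {x y : M} (h : x = y) {v : TangentSpace 𝓘(ℝ, E) x}
    {w : TangentSpace 𝓘(ℝ, E) y} (hvw : (show E from v) = w) :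
    (⟨x, v⟩ : TangentBundle 𝓘(ℝ, E) M) = ⟨y, w⟩ := by
  subst h
  exact congrArg (TotalSpace.mk x) hvw

/-- The coefficients of a smooth vector field in a smooth frame are smooth. -/
theorem contMDiffAt_of_vec_eq [FiniteDimensional ℝ E]
    {EN : Type*} [NormedAddCommGroup EN] [NormedSpace ℝ EN]
    {N : Type*} [TopologicalSpace N] [ChartedSpace EN N]
    {f : N → FrameBundle F} {v : N → TangentBundle 𝓘(ℝ, E) M} {z : N → Rn n} {u₀ : N}
    (hf : ContMDiffAt 𝓘(ℝ, EN) (𝓘(ℝ, E).prod 𝓘(ℝ, Rn n →L[ℝ] E)) ∞ (fun u => (f u).toHom) u₀)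
    (hv : ContMDiffAt 𝓘(ℝ, EN) 𝓘(ℝ, E).tangent ∞ v u₀)
    (h : ∀ᶠ u in 𝓝 u₀, (f u).base = (v u).1 ∧ (f u).vec (z u) = (v u).2) :
    ContMDiffAt 𝓘(ℝ, EN) 𝓘(ℝ, Rn n) ∞ z u₀ := by
  have h' : ∀ᶠ u in 𝓝 u₀, v u = ⟨(f u).base, ((f u).frame (z u)).1⟩ :=
    h.mono fun u hu => (totalSpace_mk_congr hu.1 hu.2).symm
  have hv' := (contMDiffAt_tangentBundle_iff.1 (hv.congr_of_eventuallyEq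
    (h'.mono fun u hu => hu.symm))).2
  have hf' := (contMDiffAt_homBundle_iff.1 hf)
  refine contMDiffAt_of_injective_apply_eq hf'.2 hv' ?_ (Eventually.of_forall fun u => rfl)
  exact (tangentCoord_injective (FiberBundle.mem_baseSet_trivializationAt' _)).comp
    (f u₀).vec_injective

end Frames

/-! ### The form of a partial structure and lifts of vector fields -/

section Forms

variable {n : ℕ} {𝔤 : Type*} [NormedAddCommGroup 𝔤] [NormedSpace ℝ 𝔤]
  {G : Type*} [TopologicalSpace G] [ChartedSpace 𝔤 G] [Group G]
  {E : Type*} [NormedAddCommGroup E] [NormedSpace ℝ E]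
  {M : Type*} [TopologicalSpace M] [ChartedSpace E M] [IsManifold 𝓘(ℝ, E) ∞ M]
  {EP : Type*} [NormedAddCommGroup EP] [NormedSpace ℝ EP]
  {P : Type*} [TopologicalSpace P] [ChartedSpace EP P] [IsManifold 𝓘(ℝ, EP) ∞ P]
  [MulAction Gᵐᵒᵖ P]
  {c : Covering (𝔤 := 𝔤) n G} {F : InvolutiveDistribution n E M}
  {B : PrincipalBundle 𝔤 G E M EP P}

omit [IsManifold 𝓘(ℝ, EP) ∞ P] in
theorem PartialStructure.coe_frameAt (Φ : PartialStructure c F B) (u : P) (z : Rn n) :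
    (show E from (Φ.frameAt u z).1) = (Φ.toFun u).vec z := by
  have key : ∀ (w : FrameBundle F) (x : M) (h : w.base = x),
      (show E from ((Eq.rec (motive := fun x _ => Rn n ≃ₗ[ℝ] F.space x) w.frame h :
        Rn n ≃ₗ[ℝ] F.space x) z).1) = w.vec z := by
    rintro w _ rfl; rfl
  exact key _ _ _

omit [IsManifold 𝓘(ℝ, EP) ∞ P] in
/-- The defining equation of the form: `Φ(u) (θ(u) ξ) = T_u p ξ`. -/
theorem PartialStructure.form_eq_iff (Φ : PartialStructure c F B) {u : P} {ξ : lift F B u}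
    {z : Rn n} : Φ.form u ξ = z ↔ (Φ.toFun u).vec z = B.tproj u ξ := by
  have h : Φ.form u ξ = z ↔ (⟨B.tproj u ξ, ξ.2⟩ : F.space (B.proj u)) = Φ.frameAt u z :=
    (Φ.frameAt u).symm_apply_eq
  rw [h, Subtype.ext_iff, eq_comm, ← Φ.coe_frameAt u z]
  exact Iff.rfl

omit [IsManifold 𝓘(ℝ, EP) ∞ P] in
theorem PartialStructure.vec_form (Φ : PartialStructure c F B) (u : P) (ξ : lift F B u) :
    (Φ.toFun u).vec (Φ.form u ξ) = B.tproj u ξ :=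
  Φ.form_eq_iff.1 rfl

/-- The form of a partial structure takes smooth values along every smooth map `v` into
`F̃ ⊆ TP`. -/
theorem PartialStructure.contMDiffAt_form [FiniteDimensional ℝ E]
    {EN : Type*} [NormedAddCommGroup EN] [NormedSpace ℝ EN]
    {N : Type*} [TopologicalSpace N] [ChartedSpace EN N] (Φ : PartialStructure c F B)
    {v : N → TangentBundle 𝓘(ℝ, EP) P} {u₀ : N}
    (hv : ContMDiffAt 𝓘(ℝ, EN) 𝓘(ℝ, EP).tangent ∞ v u₀)
    (hmem : ∀ u, (v u).2 ∈ lift F B (v u).1) :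
    ContMDiffAt 𝓘(ℝ, EN) 𝓘(ℝ, Rn n) ∞ (fun u => Φ.form (v u).1 ⟨(v u).2, hmem u⟩) u₀ := by
  have hp : ContMDiff 𝓘(ℝ, EP).tangent 𝓘(ℝ, E).tangent ∞
      (tangentMap 𝓘(ℝ, EP) 𝓘(ℝ, E) B.proj) :=
    B.smooth_proj.contMDiff_tangentMap le_rfl
  refine contMDiffAt_of_vec_eq (f := fun u => Φ.toFun (v u).1)
    (v := fun u => tangentMap 𝓘(ℝ, EP) 𝓘(ℝ, E) B.proj (v u)) ?_ ((hp _).comp u₀ hv) ?_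
  · exact ContMDiffAt.comp u₀ (Φ.smooth (v u₀).1) (contMDiffAt_tangentBundle_iff.1 hv).1
  · exact Eventually.of_forall fun u => ⟨Φ.base_toFun _, Φ.vec_form _ _⟩

/-- Near each point of `P` there is a smooth linear right inverse `H` of the tangent map of the
projection. It is the derivative of the sections of `P` that are constant in a local
trivialization. -/
theorem PrincipalBundle.exists_local_lift (B : PrincipalBundle 𝔤 G E M EP P) (u₀ : P) :
    ∃ (V : Set P) (H : ∀ u : P, TangentSpace 𝓘(ℝ, E) (B.proj u) →ₗ[ℝ] TangentSpace 𝓘(ℝ, EP) u),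
      IsOpen V ∧ u₀ ∈ V ∧ (∀ u ∈ V, ∀ v, B.tproj u (H u v) = v) ∧
      ∀ u ∈ V, ∀ X : ∀ x : M, TangentSpace 𝓘(ℝ, E) x,
        ContMDiffAt 𝓘(ℝ, E) 𝓘(ℝ, E).tangent ∞ (fun x => (⟨x, X x⟩ : TangentBundle 𝓘(ℝ, E) M))
          (B.proj u) →
        ContMDiffAt 𝓘(ℝ, EP) 𝓘(ℝ, EP).tangent ∞
          (fun u => (⟨u, H u (X (B.proj u))⟩ : TangentBundle 𝓘(ℝ, EP) P)) u := by
  obtain ⟨e, he, hsm, hsymm, -⟩ := B.locally_trivial (B.proj u₀)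
  let s : P → M → P := fun u x => e.toOpenPartialHomeomorph.symm (x, (e u).2)
  have hs_self : ∀ u ∈ e.source, s u (B.proj u) = u := fun u hu => by
    have : (B.proj u, (e u).2) = e u := Prod.ext (e.coe_fst hu).symm rfl
    simp only [s, this]
    exact e.left_inv hu
  have hs2 : ∀ u ∈ e.source, ContMDiffAt (𝓘(ℝ, EP).prod 𝓘(ℝ, E)) 𝓘(ℝ, EP) ∞
      (Function.uncurry s) (u, B.proj u) := fun u hu => by
    have hsnd : ContMDiffAt (𝓘(ℝ, EP).prod 𝓘(ℝ, E)) 𝓘(ℝ, 𝔤) ∞ (fun q : P × M => (e q.1).2)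
        (u, B.proj u) :=
      ContMDiffAt.comp (u, B.proj u) (g := fun u => (e u).2) (f := Prod.fst)
        (contMDiffAt_snd.comp u (hsm.contMDiffAt (e.open_source.mem_nhds hu))) contMDiffAt_fst
    have htgt : (B.proj u, (e u).2) ∈ e.target := by
      rw [e.mem_target]; exact e.mem_source.1 hu
    exact ContMDiffAt.comp (u, B.proj u)
      (g := e.toOpenPartialHomeomorph.symm) (f := fun q : P × M => (q.2, (e q.1).2))
      (hsymm.contMDiffAt (e.open_target.mem_nhds htgt)) (contMDiffAt_snd.prodMk hsnd)
  have hs1 : ∀ u ∈ e.source, ContMDiffAt 𝓘(ℝ, E) 𝓘(ℝ, EP) ∞ (s u) (B.proj u) := fun u hu =>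
    (hs2 u hu).comp (B.proj u) (contMDiffAt_const.prodMk contMDiffAt_id)
  refine ⟨e.source, fun u => (mfderiv 𝓘(ℝ, E) 𝓘(ℝ, EP) (s u) (B.proj u)).toLinearMap,
    e.open_source, e.mem_source.2 he, fun u hu v => ?_, fun u hu X hX => ?_⟩
  · have hps : B.proj ∘ s u =ᶠ[𝓝 (B.proj u)] id := by
      filter_upwards [e.open_baseSet.mem_nhds (e.mem_source.1 hu)] with x hx
      exact e.proj_symm_apply' hx
    have hd := mfderiv_comp (I := 𝓘(ℝ, E)) (I' := 𝓘(ℝ, EP)) (I'' := 𝓘(ℝ, E)) (B.proj u)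
      ((B.smooth_proj (s u (B.proj u))).mdifferentiableAt (by simp))
      ((hs1 u hu).mdifferentiableAt (by simp))
    rw [hps.mfderiv_eq, mfderiv_id] at hd
    have hd' : v = mfderiv 𝓘(ℝ, EP) 𝓘(ℝ, E) B.proj (s u (B.proj u))
        (mfderiv 𝓘(ℝ, E) 𝓘(ℝ, EP) (s u) (B.proj u) v) := ContinuousLinearMap.ext_iff.1 hd v
    have key : ∀ y, y = u → ∀ ξ : EP, (show E from mfderiv 𝓘(ℝ, EP) 𝓘(ℝ, E) B.proj y ξ) =
      mfderiv 𝓘(ℝ, EP) 𝓘(ℝ, E) B.proj u ξ := by rintro y rfl ξ; rfl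
    exact (key _ (hs_self u hu) _).symm.trans hd'.symm
  · have hφ := ContMDiffAt.mfderiv (m := ∞) s B.proj (hs2 u hu) (B.smooth_proj u) le_rfl
    have hv := hX.comp u (B.smooth_proj u)
    have hb₂ : ContMDiffAt 𝓘(ℝ, EP) 𝓘(ℝ, EP) ∞ (fun u => s u (B.proj u)) u :=
      ContMDiffAt.comp u (g := Function.uncurry s) (f := fun u => (u, B.proj u)) (hs2 u hu)
        (contMDiffAt_id.prodMk (B.smooth_proj u))
    have := ContMDiffAt.clm_apply_of_inCoordinates (E₁ := fun x : M => TangentSpace 𝓘(ℝ, E) x)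
      (E₂ := fun u : P => TangentSpace 𝓘(ℝ, EP) u) (v := fun u => X (B.proj u))
      (ϕ := fun u => mfderiv 𝓘(ℝ, E) 𝓘(ℝ, EP) (s u) (B.proj u)) hφ hv hb₂
    refine this.congr_of_eventuallyEq ?_
    filter_upwards [e.open_source.mem_nhds hu] with u' hu'
    exact totalSpace_mk_congr (hs_self u' hu').symm rfl

theorem PrincipalBundle.tproj_surjective (B : PrincipalBundle 𝔤 G E M EP P) (u : P) :
    Function.Surjective (B.tproj u) := by
  obtain ⟨V, H, -, hu, hH, -⟩ := B.exists_local_lift u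
  exact fun v => ⟨H u v, hH u hu v⟩

theorem exists_lift_tproj_eq (u : P) (v : F.space (B.proj u)) :
    ∃ ξ : lift F B u, B.tproj u ξ = v := by
  obtain ⟨ξ, hξ⟩ := B.tproj_surjective u v
  refine ⟨⟨ξ, ?_⟩, hξ⟩
  change B.tproj u ξ ∈ F.space (B.proj u)
  rw [hξ]; exact v.2

end Forms

/-! ### The correspondence between structures and forms -/

section Correspondence

variable {n : ℕ} {𝔤 : Type*} [NormedAddCommGroup 𝔤] [NormedSpace ℝ 𝔤]
  {G : Type*} [TopologicalSpace G] [ChartedSpace 𝔤 G] [Group G]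
  {E : Type*} [NormedAddCommGroup E] [NormedSpace ℝ E]
  {M : Type*} [TopologicalSpace M] [ChartedSpace E M] [IsManifold 𝓘(ℝ, E) ∞ M]
  {EP : Type*} [NormedAddCommGroup EP] [NormedSpace ℝ EP]
  {P : Type*} [TopologicalSpace P] [ChartedSpace EP P] [IsManifold 𝓘(ℝ, EP) ∞ P]
  [MulAction Gᵐᵒᵖ P]
  {c : Covering (𝔤 := 𝔤) n G} {F : InvolutiveDistribution n E M}
  {B : PrincipalBundle 𝔤 G E M EP P}

omit [IsManifold 𝓘(ℝ, E) ∞ M] [IsManifold 𝓘(ℝ, EP) ∞ P] in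
theorem PrincipalBundle.tproj_act (B : PrincipalBundle 𝔤 G E M EP P) (u : P) (g : G)
    (ξ : TangentSpace 𝓘(ℝ, EP) u) :
    (show E from B.tproj (u <• g) (mfderiv 𝓘(ℝ, EP) 𝓘(ℝ, EP) (fun u : P => u <• g) u ξ)) =
      B.tproj u ξ := by
  have hact : ContMDiff 𝓘(ℝ, EP) 𝓘(ℝ, EP) ∞ (fun u : P => u <• g) :=
    B.smooth_act.comp (contMDiff_id.prodMk contMDiff_const)
  have hcomp : B.proj ∘ (fun u : P => u <• g) = B.proj := funext fun u => B.proj_act u g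
  have hd := mfderiv_comp (I := 𝓘(ℝ, EP)) (I' := 𝓘(ℝ, EP)) (I'' := 𝓘(ℝ, E)) u
    ((B.smooth_proj (u <• g)).mdifferentiableAt (by simp))
    ((hact u).mdifferentiableAt (by simp))
  rw [hcomp] at hd
  exact (ContinuousLinearMap.ext_iff.1 hd ξ).symm

omit [IsManifold 𝓘(ℝ, EP) ∞ P] in
theorem PartialStructure.form_isStrictlyHorizontal (Φ : PartialStructure c F B) :
    Φ.form.IsStrictlyHorizontal := by
  intro u
  ext ξ
  constructor
  · rintro ⟨ξ, hξ, rfl⟩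
    have := Φ.form_eq_iff.1 (LinearMap.mem_ker.1 hξ)
    exact this.symm.trans (congrArg Subtype.val (map_zero (Φ.toFun u).frame))
  · intro hξ
    have h0 : B.tproj u ξ = 0 := hξ
    refine ⟨⟨ξ, ?_⟩, LinearMap.mem_ker.2 (Φ.form_eq_iff.2 ?_), rfl⟩
    · change B.tproj u ξ ∈ F.space (B.proj u)
      rw [h0]; exact zero_mem _
    · exact (congrArg Subtype.val (map_zero (Φ.toFun u).frame)).trans h0.symm

theorem Covering.rep_toEquiv_rep_inv (c : Covering (𝔤 := 𝔤) n G) (g : G) (z : Rn n) :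
    (c.rep g).toEquiv ((c.rep g⁻¹).toEquiv z) = z := by
  rw [map_inv]
  exact ContinuousLinearMap.ext_iff.1 (c.rep g).mul_inv z

theorem Covering.rep_inv_toEquiv_rep (c : Covering (𝔤 := 𝔤) n G) (g : G) (z : Rn n) :
    (c.rep g⁻¹).toEquiv ((c.rep g).toEquiv z) = z := by
  rw [map_inv]
  exact ContinuousLinearMap.ext_iff.1 (c.rep g).inv_mul z

theorem PartialStructure.form_isEquivariant (Φ : PartialStructure c F B) :
    Φ.form.IsEquivariant c := by
  intro g
  funext u
  refine LinearMap.ext fun ξ => Φ.form_eq_iff.2 ?_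
  rw [Φ.equivariant, FrameBundle.vec_act]
  change (Φ.toFun u).vec ((c.rep g).toEquiv ((c.rep g⁻¹).toEquiv (Φ.form u ξ))) = _
  rw [c.rep_toEquiv_rep_inv, Φ.vec_form]
  exact (B.tproj_act u g ξ).symm

theorem PartialStructure.form_isSmooth [FiniteDimensional ℝ E] (Φ : PartialStructure c F B) :
    Φ.form.IsSmooth := fun _ ξ hW hξ _u hu =>
  (Φ.contMDiffAt_form (hξ.contMDiffAt (hW.mem_nhds hu)) fun u => (ξ u).2).contMDiffWithinAt

/-- `Φ(u) z` is recovered from the form as `T_u p ξ` for any `ξ` with `θ(u) ξ = z`; such `ξ` exist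
because `T_u p` is onto. -/
theorem PartialStructure.form_injective :
    Function.Injective (fun Φ : PartialStructure c F B => Φ.form) := by
  intro Φ Φ' h
  have : Φ.toFun = Φ'.toFun := funext fun u => by
    refine FrameBundle.ext_vec ((Φ.base_toFun u).trans (Φ'.base_toFun u).symm) fun z => ?_
    obtain ⟨ξ, hξ⟩ := exists_lift_tproj_eq u (Φ.frameAt u z)
    have hz : (Φ.toFun u).vec z = B.tproj u ξ := (Φ.coe_frameAt u z).symm.trans hξ.symm
    have hz' : Φ'.form u ξ = z := by
      rw [← show Φ.form = Φ'.form from h]; exact Φ.form_eq_iff.2 hz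
    exact hz.trans (Φ'.form_eq_iff.1 hz').symm
  cases Φ; cases Φ'; cases this; rfl

/-- A strictly horizontal form induces an isomorphism `F_{p(u)} ≅ F̃_u / ker T_u p → ℝⁿ`: it is
injective by strict horizontality and both sides have dimension `n`. -/
theorem RoughForm.IsStrictlyHorizontal.exists_frame [FiniteDimensional ℝ E] {θ : RoughForm F B}
    (hθ : θ.IsStrictlyHorizontal) (u : P) :
    ∃ φ : Rn n ≃ₗ[ℝ] F.space (B.proj u), ∀ ξ : lift F B u, (φ (θ u ξ)).1 = B.tproj u ξ := by
  obtain ⟨H, hH⟩ := (B.tproj u).exists_rightInverse_of_surjective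
    (LinearMap.range_eq_top.2 (B.tproj_surjective u))
  have hH' : ∀ v, B.tproj u (H v) = v := LinearMap.ext_iff.1 hH
  have hker : ∀ ξ : lift F B u, θ u ξ = 0 ↔ B.tproj u ξ = 0 := fun ξ => by
    rw [← LinearMap.mem_ker (f := B.tproj u), ← hθ u]
    constructor
    · exact fun h => ⟨ξ, h, rfl⟩
    · rintro ⟨ξ', h, h'⟩
      rwa [← Subtype.ext h']
  let H' : F.space (B.proj u) →ₗ[ℝ] lift F B u :=
    H.restrict fun v hv => by
      change B.tproj u (H v) ∈ F.space (B.proj u)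
      rwa [hH']
  have hinj : Function.Injective (θ u ∘ₗ H') := by
    rw [injective_iff_map_eq_zero]
    intro v hv
    have : B.tproj u (H v) = 0 := (hker (H' v)).1 hv
    exact Subtype.ext ((hH' v).symm.trans this)
  have : FiniteDimensional ℝ (TangentSpace 𝓘(ℝ, E) (B.proj u)) :=
    inferInstanceAs (FiniteDimensional ℝ E)
  let ψ := LinearEquiv.ofInjectiveOfFinrankEq (θ u ∘ₗ H') hinj
    ((F.rank_eq _).trans finrank_euclideanSpace_fin.symm)
  refine ⟨ψ.symm, fun ξ => ?_⟩
  suffices h : θ u ξ = ψ ⟨B.tproj u ξ, ξ.2⟩ by rw [h, ψ.symm_apply_apply]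
  have h0 : θ u (ξ - H' ⟨B.tproj u ξ, ξ.2⟩) = 0 := by
    rw [hker]
    change B.tproj u (ξ - H (B.tproj u ξ)) = 0
    rw [map_sub, hH', sub_self]
  rw [map_sub, sub_eq_zero] at h0
  exact h0

/-- The frames determined by a smooth form vary smoothly. Near a point, a smooth local frame
`X i` of `F` lifts to sections `ξ i` of `F̃`; the matrix `A u` with columns `θ(u)(ξ i)` is smooth
and invertible, and the frame at `u` is `X ∘ (A u)⁻¹`. -/
theorem RoughForm.IsSmooth.smoothToFrameBundle [FiniteDimensional ℝ E] {θ : RoughForm F B}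
    (hθ : θ.IsSmooth) {φ : ∀ u, Rn n ≃ₗ[ℝ] F.space (B.proj u)}
    (hφ : ∀ u (ξ : lift F B u), (φ u (θ u ξ)).1 = B.tproj u ξ) :
    SmoothToFrameBundle (EN := EP) (fun u => (⟨B.proj u, φ u⟩ : FrameBundle F)) := by
  classical
  intro u₀
  obtain ⟨U, hU, hu₀U, X, hX, hspan⟩ := F.smooth (B.proj u₀)
  obtain ⟨V, H, hV, hu₀V, hH, hHsm⟩ := B.exists_local_lift u₀
  let W : Set P := V ∩ B.proj ⁻¹' U
  have hW : IsOpen W := hV.inter (hU.preimage B.smooth_proj.continuous)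
  have hu₀ : u₀ ∈ W := ⟨hu₀V, hu₀U⟩
  have hXF : ∀ u ∈ W, ∀ i, X i (B.proj u) ∈ F.space (B.proj u) := fun u hu i => by
    rw [hspan _ hu.2]; exact Submodule.subset_span ⟨i, rfl⟩
  have hmem : ∀ u (hu : u ∈ W) i, H u (X i (B.proj u)) ∈ lift F B u := fun u hu i => by
    change B.tproj u (H u _) ∈ F.space (B.proj u)
    rw [hH u hu.1]; exact hXF u hu i
  let ξ : Fin n → ∀ u : P, lift F B u := fun i u =>
    if hu : u ∈ W then ⟨H u (X i (B.proj u)), hmem u hu i⟩ else 0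
  have hξ : ∀ u ∈ W, ∀ i, ((ξ i u : lift F B u) : TangentSpace 𝓘(ℝ, EP) u) =
      H u (X i (B.proj u)) := fun u hu i => by simp only [ξ, dif_pos hu]
  have hξsm : ∀ i, SmoothFieldOn EP
      (fun u => ((ξ i u : lift F B u) : TangentSpace 𝓘(ℝ, EP) u)) W := by
    intro i u hu
    have h := hHsm u hu.1 (X i) ((hX i).contMDiffAt (hU.mem_nhds hu.2))
    refine (h.congr_of_eventuallyEq ?_).contMDiffWithinAt
    filter_upwards [hW.mem_nhds hu] with u' hu'
    rw [hξ u' hu' i]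
  have hθξ : ∀ i, ContMDiffAt 𝓘(ℝ, EP) 𝓘(ℝ, Rn n) ∞ (fun u => θ u (ξ i u)) u₀ := fun i =>
    (hθ W (ξ i) hW (hξsm i)).contMDiffAt (hW.mem_nhds hu₀)
  let A : P → Rn n →L[ℝ] Rn n := fun u =>
    ∑ i, (EuclideanSpace.proj i : Rn n →L[ℝ] ℝ).smulRight (θ u (ξ i u))
  have hAapp : ∀ u z, A u z = ∑ i, z i • θ u (ξ i u) := fun u z => by
    simp [A]
  have hA : ContMDiffAt 𝓘(ℝ, EP) 𝓘(ℝ, Rn n →L[ℝ] Rn n) ∞ A u₀ := by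
    refine ContMDiffAt.sum fun i _ => ?_
    exact (ContinuousLinearMap.smulRightL ℝ (Rn n) (Rn n)
      (EuclideanSpace.proj i : Rn n →L[ℝ] ℝ)).contMDiff.contMDiffAt.comp u₀ (hθξ i)
  have hφA : ∀ u ∈ W, ∀ z, (φ u (A u z)).1 = ∑ i, z i • X i (B.proj u) := fun u hu z => by
    rw [hAapp, map_sum, Submodule.coe_sum]
    refine Finset.sum_congr rfl fun i _ => ?_
    rw [map_smul, Submodule.coe_smul, hφ, hξ u hu, hH u hu.1]
  have hunit : IsUnit (A u₀) := by
    have hsurj : Function.Surjective (A u₀) := fun z => by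
      have hz : (φ u₀ z).1 ∈ Submodule.span ℝ (range fun i => X i (B.proj u₀)) := by
        rw [← hspan _ hu₀U]; exact (φ u₀ z).2
      obtain ⟨a, ha⟩ := (Submodule.mem_span_range_iff_exists_fun ℝ).1 hz
      refine ⟨WithLp.toLp 2 a, (φ u₀).injective (Subtype.ext ?_)⟩
      rw [hφA u₀ hu₀]
      exact ha
    rw [ContinuousLinearMap.isUnit_iff_bijective]
    exact ⟨LinearMap.injective_iff_surjective.2 (show Function.Surjective (A u₀).toLinearMap from
      hsurj), hsurj⟩
  have hXcoord : ∀ i, ContMDiffAt 𝓘(ℝ, EP) 𝓘(ℝ, E) ∞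
      (fun u => tangentCoord (E := E) (B.proj u₀) (B.proj u) (X i (B.proj u))) u₀ := fun i =>
    (contMDiffAt_tangentBundle_iff.1 (ContMDiffAt.comp u₀
      ((hX i).contMDiffAt (hU.mem_nhds hu₀U)) (B.smooth_proj u₀))).2
  let C : P → Rn n →L[ℝ] E := fun u => ∑ i, (EuclideanSpace.proj i : Rn n →L[ℝ] ℝ).smulRight
    (tangentCoord (E := E) (B.proj u₀) (B.proj u) (X i (B.proj u)))
  have hC : ContMDiffAt 𝓘(ℝ, EP) 𝓘(ℝ, Rn n →L[ℝ] E) ∞ C u₀ := by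
    refine ContMDiffAt.sum fun i _ => ?_
    exact (ContinuousLinearMap.smulRightL ℝ (Rn n) E
      (EuclideanSpace.proj i : Rn n →L[ℝ] ℝ)).contMDiff.contMDiffAt.comp u₀ (hXcoord i)
  refine contMDiffAt_homBundle_iff.2 ⟨B.smooth_proj u₀, ?_⟩
  refine (hC.clm_comp (contMDiffAt_ringInverse hA hunit)).congr_of_eventuallyEq ?_
  filter_upwards [hW.mem_nhds hu₀, eventually_isUnit hA.continuousAt hunit] with u hu hAu
  refine ContinuousLinearMap.ext fun z => ?_
  have h1 : C u (Ring.inverse (A u) z) =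
      tangentCoord (E := E) (B.proj u₀) (B.proj u) (φ u (A u (Ring.inverse (A u) z))).1 := by
    rw [hφA u hu, map_sum]
    simp [C]
  rw [apply_ringInverse_apply hAu] at h1
  exact h1.symm

/-- A smooth, strictly horizontal, equivariant form is the form of a partial structure. -/
theorem RoughForm.exists_form_eq [FiniteDimensional ℝ E] {θ : RoughForm F B}
    (hs : θ.IsSmooth) (hh : θ.IsStrictlyHorizontal) (he : θ.IsEquivariant c) :
    ∃ Φ : PartialStructure c F B, Φ.form = θ := by
  choose φ hφ using hh.exists_frame
  refine ⟨⟨fun u => ⟨B.proj u, φ u⟩, fun _ => rfl, hs.smoothToFrameBundle hφ, fun u g => ?_⟩, ?_⟩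
  · refine FrameBundle.ext_vec (B.proj_act u g) fun z => ?_
    obtain ⟨ξ, hξ⟩ := exists_lift_tproj_eq u (φ u ((c.rep g).toEquiv z))
    have h1 : θ u ξ = (c.rep g).toEquiv z :=
      (φ u).injective (Subtype.ext ((hφ u ξ).trans hξ))
    have h2 : θ (u <• g) ⟨_, mapsLift_act F B g u ξ ξ.2⟩ = z := by
      have := LinearMap.ext_iff.1 (congrFun (he g) u) ξ
      refine Eq.trans this ?_
      change (c.rep g⁻¹).toEquiv (θ u ξ) = z
      rw [h1, c.rep_inv_toEquiv_rep]
    have h3 := hφ (u <• g) ⟨_, mapsLift_act F B g u ξ ξ.2⟩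
    rw [h2] at h3
    exact (Eq.trans h3 (B.tproj_act u g ξ)).trans hξ
  · funext u
    exact LinearMap.ext fun ξ => (PartialStructure.form_eq_iff _).2 (hφ u ξ)

end Correspondence

/-! ### Homomorphisms of principal bundles and morphisms -/

section Morphisms

variable {n : ℕ}
  {E₁ : Type*} [NormedAddCommGroup E₁] [NormedSpace ℝ E₁]
  {M₁ : Type*} [TopologicalSpace M₁] [ChartedSpace E₁ M₁] [IsManifold 𝓘(ℝ, E₁) ∞ M₁]
  {E₂ : Type*} [NormedAddCommGroup E₂] [NormedSpace ℝ E₂]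
  {M₂ : Type*} [TopologicalSpace M₂] [ChartedSpace E₂ M₂] [IsManifold 𝓘(ℝ, E₂) ∞ M₂]
  {F₁ : InvolutiveDistribution n E₁ M₁} {F₂ : InvolutiveDistribution n E₂ M₂}
  {𝔤 : Type*} [NormedAddCommGroup 𝔤] [NormedSpace ℝ 𝔤]
  {G : Type*} [TopologicalSpace G] [ChartedSpace 𝔤 G] [Group G]
  {EP₁ : Type*} [NormedAddCommGroup EP₁] [NormedSpace ℝ EP₁]
  {P₁ : Type*} [TopologicalSpace P₁] [ChartedSpace EP₁ P₁] [IsManifold 𝓘(ℝ, EP₁) ∞ P₁]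
  [MulAction Gᵐᵒᵖ P₁]
  {EP₂ : Type*} [NormedAddCommGroup EP₂] [NormedSpace ℝ EP₂]
  {P₂ : Type*} [TopologicalSpace P₂] [ChartedSpace EP₂ P₂] [IsManifold 𝓘(ℝ, EP₂) ∞ P₂]
  [MulAction Gᵐᵒᵖ P₂]
  {c : Covering (𝔤 := 𝔤) n G}
  {B₁ : PrincipalBundle 𝔤 G E₁ M₁ EP₁ P₁} {B₂ : PrincipalBundle 𝔤 G E₂ M₂ EP₂ P₂}

omit [IsManifold 𝓘(ℝ, E₁) ∞ M₁] [IsManifold 𝓘(ℝ, E₂) ∞ M₂] [IsManifold 𝓘(ℝ, EP₁) ∞ P₁]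
  [IsManifold 𝓘(ℝ, EP₂) ∞ P₂] in
theorem PrincipalBundleHom.tproj_mfderiv (Ψ : PrincipalBundleHom B₁ B₂) (u : P₁)
    (ξ : TangentSpace 𝓘(ℝ, EP₁) u) :
    (show E₂ from B₂.tproj (Ψ.toFun u) (mfderiv 𝓘(ℝ, EP₁) 𝓘(ℝ, EP₂) Ψ.toFun u ξ)) =
      mfderiv 𝓘(ℝ, E₁) 𝓘(ℝ, E₂) Ψ.base (B₁.proj u) (B₁.tproj u ξ) := by
  have hcomp : B₂.proj ∘ Ψ.toFun = Ψ.base ∘ B₁.proj := funext Ψ.proj_toFun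
  have h₂ := mfderiv_comp (I := 𝓘(ℝ, EP₁)) (I' := 𝓘(ℝ, EP₂)) (I'' := 𝓘(ℝ, E₂)) u
    ((B₂.smooth_proj (Ψ.toFun u)).mdifferentiableAt (by simp))
    ((Ψ.smooth_toFun u).mdifferentiableAt (by simp))
  have h₁ := mfderiv_comp (I := 𝓘(ℝ, EP₁)) (I' := 𝓘(ℝ, E₁)) (I'' := 𝓘(ℝ, E₂)) u
    ((Ψ.smooth_base (B₁.proj u)).mdifferentiableAt (by simp))
    ((B₁.smooth_proj u).mdifferentiableAt (by simp))
  rw [hcomp] at h₂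
  exact ContinuousLinearMap.ext_iff.1 (h₂.symm.trans h₁) ξ

omit [IsManifold 𝓘(ℝ, EP₁) ∞ P₁] [IsManifold 𝓘(ℝ, EP₂) ∞ P₂] in
theorem PrincipalBundleHom.mapsLift (Ψ : PrincipalBundleHom B₁ B₂)
    (h : RestrictsToIso F₁ F₂ Ψ.base) : MapsLift F₁ B₁ F₂ B₂ Ψ.toFun := by
  intro u ξ hξ
  have key : ∀ (x y : M₂), x = y → ∀ v w : E₂, v = w →
      (show TangentSpace 𝓘(ℝ, E₂) x from v) ∈ F₂.space x →
      (show TangentSpace 𝓘(ℝ, E₂) y from w) ∈ F₂.space y := by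
    rintro x _ rfl v _ rfl hv; exact hv
  exact key _ _ (Ψ.proj_toFun u).symm _ _ (Ψ.tproj_mfderiv u ξ).symm
    ((h (B₁.proj u)).mapsTo hξ)

theorem PrincipalBundleHom.pullback_form_isSmooth [FiniteDimensional ℝ E₂]
    (Ψ : PrincipalBundleHom B₁ B₂) (Φ₂ : PartialStructure c F₂ B₂)
    (hΨ : MapsLift F₁ B₁ F₂ B₂ Ψ.toFun) : (Φ₂.form.pullback Ψ.toFun hΨ).IsSmooth := by
  intro W ξ hW hξ u hu
  have hT : ContMDiff 𝓘(ℝ, EP₁).tangent 𝓘(ℝ, EP₂).tangent ∞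
      (tangentMap 𝓘(ℝ, EP₁) 𝓘(ℝ, EP₂) Ψ.toFun) :=
    Ψ.smooth_toFun.contMDiff_tangentMap le_rfl
  exact (Φ₂.contMDiffAt_form ((hT _).comp u (hξ.contMDiffAt (hW.mem_nhds hu)))
    fun u => hΨ u _ (ξ u).2).contMDiffWithinAt

theorem RestrictsToIso.vec_frameMap {f : M₁ → M₂} (h : RestrictsToIso F₁ F₂ f)
    (w : FrameBundle F₁) {x : M₁} (hx : w.base = x) (z : Rn n) :
    (h.frameMap w).vec z = mfderiv 𝓘(ℝ, E₁) 𝓘(ℝ, E₂) f x (w.vec z) := by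
  subst hx; rfl

omit [IsManifold 𝓘(ℝ, EP₂) ∞ P₂] in
theorem PrincipalBundleHom.isMorphism_iff (Ψ : PrincipalBundleHom B₁ B₂)
    (Φ₁ : PartialStructure c F₁ B₁) (Φ₂ : PartialStructure c F₂ B₂)
    (h : RestrictsToIso F₁ F₂ Ψ.base) (hΨ : MapsLift F₁ B₁ F₂ B₂ Ψ.toFun) :
    IsMorphism Φ₁ Φ₂ Ψ ↔ Φ₂.form.pullback Ψ.toFun hΨ = Φ₁.form := by
  constructor
  · rintro ⟨h', hm⟩
    funext u
    refine LinearMap.ext fun ξ => Φ₂.form_eq_iff.2 ?_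
    rw [hm u, h'.vec_frameMap _ (Φ₁.base_toFun u), Φ₁.vec_form]
    exact (Ψ.tproj_mfderiv u ξ).symm
  · intro he
    refine ⟨h, fun u => FrameBundle.ext_vec ?_ fun z => ?_⟩
    · rw [Φ₂.base_toFun, Ψ.proj_toFun, ← Φ₁.base_toFun u]; rfl
    · obtain ⟨ξ, hξ⟩ := exists_lift_tproj_eq u (Φ₁.frameAt u z)
      have hz : (Φ₁.toFun u).vec z = B₁.tproj u ξ := (Φ₁.coe_frameAt u z).symm.trans hξ.symm
      have hz₂ : Φ₂.form (Ψ.toFun u) ⟨_, hΨ u ξ ξ.2⟩ = z :=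
        (LinearMap.ext_iff.1 (congrFun he u) ξ).trans (Φ₁.form_eq_iff.2 hz)
      rw [h.vec_frameMap _ (Φ₁.base_toFun u), hz]
      exact (Φ₂.form_eq_iff.1 hz₂).trans (Ψ.tproj_mfderiv u ξ)

omit [IsManifold 𝓘(ℝ, E₂) ∞ M₂] [IsManifold 𝓘(ℝ, EP₂) ∞ P₂] in
/-- Two maps into a principal bundle that agree after projection differ by a continuous function to
the structure group: in a local trivialization it is the quotient of the two group components. -/
theorem PrincipalBundle.exists_continuous_act_eq [IsTopologicalGroup G]
    {X : Type*} [TopologicalSpace X] (B : PrincipalBundle 𝔤 G E₂ M₂ EP₂ P₂) {f f' : X → P₂}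
    (hf : Continuous f) (hf' : Continuous f') (h : ∀ x, B.proj (f x) = B.proj (f' x)) :
    ∃ g : X → G, Continuous g ∧ ∀ x, f' x = f x <• g x := by
  have hloc : ∀ (e : Trivialization G B.proj),
      (∀ u ∈ e.source, ∀ g : G, (e (u <• g)).2 = (e u).2 * g) → ∀ u ∈ e.source, ∀ u' ∈ e.source,
      B.proj u = B.proj u' → ∀ g : G, u' = u <• g ↔ g = (e u).2⁻¹ * (e u').2 := by
    intro e he u hu u' hu' hp g
    rw [eq_inv_mul_iff_mul_eq, ← he u hu g]
    have hug : u <• g ∈ e.source := by rw [e.mem_source, B.proj_act]; exact e.mem_source.1 hu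
    refine ⟨fun h => by rw [h], fun h => (e.injOn hug hu' (Prod.ext ?_ h)).symm⟩
    exact (e.coe_fst hug).trans (((B.proj_act u g).trans hp).trans (e.coe_fst hu').symm)
  have hex : ∀ x, ∃ g : G, f' x = f x <• g := fun x => by
    obtain ⟨e, hx, -, -, he⟩ := B.locally_trivial (B.proj (f x))
    exact ⟨_, (hloc e he (f x) (e.mem_source.2 hx) (f' x) (e.mem_source.2 (h x ▸ hx)) (h x) _).2
      rfl⟩
  choose g hg using hex
  refine ⟨g, continuous_iff_continuousAt.2 fun x₀ => ?_, hg⟩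
  obtain ⟨e, hx, -, -, he⟩ := B.locally_trivial (B.proj (f x₀))
  have hs : f x₀ ∈ e.source := e.mem_source.2 hx
  have hs' : f' x₀ ∈ e.source := e.mem_source.2 (h x₀ ▸ hx)
  have hc : ContinuousAt (fun x => (e (f x)).2⁻¹ * (e (f' x)).2) x₀ :=
    ((continuous_snd.continuousAt.comp ((e.continuousAt hs).comp hf.continuousAt)).inv).mul
      (continuous_snd.continuousAt.comp ((e.continuousAt hs').comp hf'.continuousAt))
  refine hc.congr ?_
  filter_upwards [hf.continuousAt.eventually (e.open_source.mem_nhds hs),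
    hf'.continuousAt.eventually (e.open_source.mem_nhds hs')] with x hx hx'
  exact ((hloc e he _ hx _ hx' (h x) _).1 (hg x)).symm

theorem Covering.discreteTopology_kernel (c : Covering (𝔤 := 𝔤) n G) :
    DiscreteTopology c.kernel :=
  (c.isCoveringMap_cov 1).discreteTopology_fiber

omit [IsManifold 𝓘(ℝ, EP₁) ∞ P₁] [IsManifold 𝓘(ℝ, EP₂) ∞ P₂] in
/-- The group-valued function relating two morphisms over the same base map acts
trivially on the frames `Φ₂ (Ψ u)`, hence takes values in the discrete kernel of the covering. -/
theorem IsMorphism.exists_isLocallyConstant [IsTopologicalGroup G]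
    {Φ₁ : PartialStructure c F₁ B₁} {Φ₂ : PartialStructure c F₂ B₂}
    {Ψ Ψ' : PrincipalBundleHom B₁ B₂} (hΨ : IsMorphism Φ₁ Φ₂ Ψ) (hΨ' : IsMorphism Φ₁ Φ₂ Ψ')
    (hb : Ψ.base = Ψ'.base) :
    ∃ g : P₁ → c.kernel, IsLocallyConstant g ∧ ∀ u : P₁, Ψ'.toFun u = Ψ.toFun u <• (g u : G) := by
  obtain ⟨g, hgc, hg⟩ := B₂.exists_continuous_act_eq Ψ.smooth_toFun.continuous
    Ψ'.smooth_toFun.continuous fun u => by rw [Ψ.proj_toFun, Ψ'.proj_toFun, hb]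
  have hframe : ∀ u, Φ₂.toFun (Ψ'.toFun u) = Φ₂.toFun (Ψ.toFun u) := fun u => by
    obtain ⟨h, hm⟩ := hΨ
    obtain ⟨h', hm'⟩ := hΨ'
    rw [hm u, hm' u]
    refine FrameBundle.ext_vec (congrFun hb _).symm fun z => ?_
    rw [h.vec_frameMap _ rfl, h'.vec_frameMap _ rfl, hb]
  have hker : ∀ u, g u ∈ c.kernel := fun u => by
    have h1 : c.rep (g u) = 1 := by
      refine FrameBundle.eq_one_of_act_eq (w := Φ₂.toFun (Ψ.toFun u)) ?_
      rw [← Φ₂.equivariant, ← hg u, hframe u]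
    exact MonoidHom.mem_ker.2 (Subtype.ext h1)
  have := c.discreteTopology_kernel
  exact ⟨fun u => ⟨g u, hker u⟩,
    (IsLocallyConstant.iff_continuous _).2 (hgc.subtype_mk hker), hg⟩

end Morphisms

end PartialGStr

end

open PartialGStr in
theorem proposition2p2 (n k₁ k₂ : ℕ)
    -- the Lie group `G₀`, a covering of a closed subgroup of `GL(n, ℝ)`
    {𝔤 : Type*} [NormedAddCommGroup 𝔤] [NormedSpace ℝ 𝔤] [FiniteDimensional ℝ 𝔤]
    {G₀ : Type*} [TopologicalSpace G₀] [ChartedSpace 𝔤 G₀] [Group G₀] [LieGroup 𝓘(ℝ, 𝔤) ∞ G₀]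
    (c : Covering (𝔤 := 𝔤) n G₀)
    -- the base manifolds, of dimensions `n + k₁` and `n + k₂`, and the distributions
    {E₁ : Type*} [NormedAddCommGroup E₁] [NormedSpace ℝ E₁] [FiniteDimensional ℝ E₁]
    (_hE₁ : Module.finrank ℝ E₁ = n + k₁)
    {M₁ : Type*} [TopologicalSpace M₁] [ChartedSpace E₁ M₁] [IsManifold 𝓘(ℝ, E₁) ∞ M₁]
    (F₁ : InvolutiveDistribution n E₁ M₁)
    {E₂ : Type*} [NormedAddCommGroup E₂] [NormedSpace ℝ E₂] [FiniteDimensional ℝ E₂]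
    (_hE₂ : Module.finrank ℝ E₂ = n + k₂)
    {M₂ : Type*} [TopologicalSpace M₂] [ChartedSpace E₂ M₂] [IsManifold 𝓘(ℝ, E₂) ∞ M₂]
    (F₂ : InvolutiveDistribution n E₂ M₂)
    -- the principal `G₀`-bundles
    {EP₁ : Type*} [NormedAddCommGroup EP₁] [NormedSpace ℝ EP₁] [FiniteDimensional ℝ EP₁]
    {P₁ : Type*} [TopologicalSpace P₁] [ChartedSpace EP₁ P₁] [IsManifold 𝓘(ℝ, EP₁) ∞ P₁]
    [MulAction G₀ᵐᵒᵖ P₁] (B₁ : PrincipalBundle 𝔤 G₀ E₁ M₁ EP₁ P₁)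
    {EP₂ : Type*} [NormedAddCommGroup EP₂] [NormedSpace ℝ EP₂] [FiniteDimensional ℝ EP₂]
    {P₂ : Type*} [TopologicalSpace P₂] [ChartedSpace EP₂ P₂] [IsManifold 𝓘(ℝ, EP₂) ∞ P₂]
    [MulAction G₀ᵐᵒᵖ P₂] (B₂ : PrincipalBundle 𝔤 G₀ E₂ M₂ EP₂ P₂) :
    -- (1) `Φ ↦ θ` is a bijection onto the smooth strictly horizontal equivariant sections
    BijOn (fun Φ : PartialStructure c F₁ B₁ => Φ.form) univ
        {θ : RoughForm F₁ B₁ | θ.IsSmooth ∧ θ.IsStrictlyHorizontal ∧ θ.IsEquivariant c} ∧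
    -- (2) the pullback is well defined, and detects morphisms
    (∀ (Φ₁ : PartialStructure c F₁ B₁) (Φ₂ : PartialStructure c F₂ B₂)
        (Ψ : PrincipalBundleHom B₁ B₂), RestrictsToIso F₁ F₂ Ψ.base →
      ∃ hΨ : MapsLift F₁ B₁ F₂ B₂ Ψ.toFun,
        (Φ₂.form.pullback Ψ.toFun hΨ).IsSmooth ∧
        (IsMorphism Φ₁ Φ₂ Ψ ↔ Φ₂.form.pullback Ψ.toFun hΨ = Φ₁.form)) ∧
    -- (3) two morphisms with the same base map differ by a locally constant function to `K`
    (∀ (Φ₁ : PartialStructure c F₁ B₁) (Φ₂ : PartialStructure c F₂ B₂)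
        (Ψ Ψ' : PrincipalBundleHom B₁ B₂), IsMorphism Φ₁ Φ₂ Ψ → IsMorphism Φ₁ Φ₂ Ψ' →
      Ψ.base = Ψ'.base →
      ∃ g : P₁ → c.kernel, IsLocallyConstant g ∧
        ∀ u : P₁, Ψ'.toFun u = Ψ.toFun u <• (g u : G₀)) := by
  refine ⟨⟨fun Φ _ => ⟨Φ.form_isSmooth, Φ.form_isStrictlyHorizontal, Φ.form_isEquivariant⟩,
    PartialStructure.form_injective.injOn, fun θ hθ => ?_⟩, fun Φ₁ Φ₂ Ψ h => ?_,
    fun Φ₁ Φ₂ Ψ Ψ' hΨ hΨ' hb => ?_⟩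
  · obtain ⟨Φ, hΦ⟩ := RoughForm.exists_form_eq hθ.1 hθ.2.1 hθ.2.2
    exact ⟨Φ, mem_univ Φ, hΦ⟩
  · exact ⟨Ψ.mapsLift h, Ψ.pullback_form_isSmooth Φ₂ _, Ψ.isMorphism_iff Φ₁ Φ₂ h _⟩
  · -- Mathlib's `LieGroup` does not register its group as topological by instance
    have := topologicalGroup_of_lieGroup 𝓘(ℝ, 𝔤) (n := ∞) (G := G₀)
    exact hΨ.exists_isLocallyConstant hΨ' hb
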